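/- Let $n,d\ge 1$ be integers and let $\Delta_1,\dots,\Delta_{n-1}>0$ satisfy $\sum_{i=1}^{n-1}\Delta_i\le\sqrt d$. A problem with $n$ experts and $d$ tasks is a family $\nu=(\nu_{ij})_{1\le i\le n,\,1\le j\le d}$ of probability distributions on $\mathbb R$; let $M=(M_{ij})$ be its matrix of means. A permutation $\pi$ of $\{1,\dots,n\}$ is the correct ranking if $M_{\pi(i),j}\ge M_{\pi(i+1),j}$ for all $i\le n-1$ and all $j\le d$. Let $\mathbb D$ be the class of all problems such that (i) every $\nu_{ij}$ is $1$-sub-Gaussian, that is, $\int e^{t(x-M_{ij})}\,d\nu_{ij}(x)\le e^{t^2/2}$ for all $t\in\mathbb R$; (ii) all $M_{ij}\in[0,1]$, the rows of $M$ are pairwise distinct, and a correct ranking $\pi$ exists (it is then unique); (iii) $\sum_{j=1}^d\bigl(M_{\pi(i),j}-M_{\pi(i+1),j}\bigr)^2=\Delta_i^2$ for $i=1,\dots,n-1$. A (possibly randomized) sequential ranking algorithm $A$ at each time, on the basis of its previous observations and its internal randomness, either queries a pair $(i,j)$ of its choice, and receives an independent sample from $\nu_{ij}$, or terminates and outputs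 a permutation $\hat\pi$. Let $N\in\{0,1,2,\dots\}\cup\{\infty\}$ be the total number of queries. Let $\delta\in(0,1)$, and let $A$ be $\delta$-accurate: $\mathbb P_{\nu,A}(\hat\pi\ne\pi)\le\delta$ for every problem $\nu\in\mathbb D$ with correct ranking $\pi$ (non-termination counts as an error). Then $$\max_{\nu\in\mathbb D}\ \mathbb E_{\nu,A}[N]\ \ge\ \sum_{i=1}^{n-1}\frac{d}{\Delta_i^2}\,\log\Bigl(\frac1{4\delta}\Bigr),$$ in the sense that some $\nu\in\mathbb D$ satisfies $\mathbb E_{\nu,A}[N]\ge\sum_{i=1}^{n-1}\frac{d}{\Delta_i^2}\log\frac1{4\delta}$. -/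

import Mathlib

open MeasureTheory ProbabilityTheory
open scoped ENNReal

noncomputable section

namespace ExpertRanking

/-- A problem with `n` experts and `d` tasks: the law `ν i j` of the performance of expert `i`
on task `j`, for every pair `(i, j)`. -/
abbrev Problem (n d : ℕ) : Type := Fin n → Fin d → ProbabilityMeasure ℝ

/-- The matrix of mean performances. -/
def meanMatrix {n d : ℕ} (ν : Problem n d) (i : Fin n) (j : Fin d) : ℝ :=
  ∫ x, x ∂(ν i j : Measure ℝ)

/-- Every `ν i j` is `1`-sub-Gaussian around its mean:
`E exp (t (X - E X)) ≤ exp (t ^ 2 / 2)` for all real `t`. -/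
def IsSubGaussian {n d : ℕ} (ν : Problem n d) : Prop :=
  ∀ i j, HasSubgaussianMGF (fun x : ℝ => x - meanMatrix ν i j) 1 (ν i j : Measure ℝ)

/-- `π` ranks the experts from best to worst: on every task the mean performance of the expert
`π i` of rank `i` is at least that of every expert `π k` of a later rank `k`. -/
def IsRanking {n d : ℕ} (M : Fin n → Fin d → ℝ) (π : Equiv.Perm (Fin n)) : Prop :=
  ∀ i k, i ≤ k → ∀ j, M (π k) j ≤ M (π i) j

/-- The admissible mean matrices: monotone up to a permutation of the experts, with entries in
`[0, 1]`, and with pairwise distinct rows (identifiability of the ranking). -/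
structure IsAdmissible {n d : ℕ} (M : Fin n → Fin d → ℝ) : Prop where
  exists_ranking : ∃ π : Equiv.Perm (Fin n), IsRanking M π
  mem_Icc : ∀ i j, M i j ∈ Set.Icc (0 : ℝ) 1
  identifiable : ∀ i k, i ≠ k → ∃ j, M i j ≠ M k j

/-- The class of problems with `m + 1` experts and `d` tasks that are `1`-sub-Gaussian, have an
admissible mean matrix, and whose consecutive experts (in the order of the ranking) are at
Euclidean distances `Δ 0, …, Δ (m - 1)`. -/
def problemClass (m d : ℕ) (Δ : Fin m → ℝ) : Set (Problem (m + 1) d) :=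
  {ν | IsSubGaussian ν ∧ IsAdmissible (meanMatrix ν) ∧
    ∀ π : Equiv.Perm (Fin (m + 1)), IsRanking (meanMatrix ν) π →
      ∀ i : Fin m, ∑ j, (meanMatrix ν (π i.castSucc) j - meanMatrix ν (π i.succ) j) ^ 2
        = Δ i ^ 2}

/-- A sequential, possibly randomized, ranking algorithm. A random seed is drawn once, at the
beginning. After `t` queries, as a measurable function of the seed and of the `t` observations
made so far (which determine the previous queries), the algorithm either queries an expert-task
pair (`Sum.inl (i, j)`) or terminates and outputs a ranking (`Sum.inr π`). -/
structure RankingAlgorithm (S : Type*) [MeasurableSpace S] (n d : ℕ) where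
  seedLaw : ProbabilityMeasure S
  decision : (t : ℕ) → S → (Fin t → ℝ) → (Fin n × Fin d) ⊕ Equiv.Perm (Fin n)
  measurableSet_decision : ∀ t a, MeasurableSet {p : S × (Fin t → ℝ) | decision t p.1 p.2 = a}

/-- The outcomes: the seed and, for every time `t`, a table with one potential sample for each
expert-task pair, of which the learner sees only the entry that it queries at time `t`. -/
abbrev Outcome (S : Type*) (n d : ℕ) : Type _ := S × (ℕ → Fin n → Fin d → ℝ)

namespace RankingAlgorithm

variable {S : Type*} [MeasurableSpace S] {n d : ℕ}

/-- The first `t` observations. (After termination nothing is observed; the value `0` is filled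
in, and it is never used.) -/
def observations (A : RankingAlgorithm S n d) (ω : Outcome S n d) : (t : ℕ) → Fin t → ℝ
  | 0 => Fin.elim0
  | t + 1 => Fin.snoc (α := fun _ => ℝ) (A.observations ω t)
      (match A.decision t ω.1 (A.observations ω t) with
        | Sum.inl q => ω.2 t q.1 q.2
        | Sum.inr _ => 0)

/-- The decision taken after `t` queries. -/
def action (A : RankingAlgorithm S n d) (ω : Outcome S n d) (t : ℕ) :
    (Fin n × Fin d) ⊕ Equiv.Perm (Fin n) :=
  A.decision t ω.1 (A.observations ω t)

open Classical in
/-- The number `N` of queries made before termination, `⊤` if the algorithm never terminates. -/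
def numQueries (A : RankingAlgorithm S n d) (ω : Outcome S n d) : ℕ∞ :=
  if h : ∃ t, (A.action ω t).isRight = true then (Nat.find h : ℕ∞) else ⊤

open Classical in
/-- The ranking that is output at termination, `none` if the algorithm never terminates. -/
def output (A : RankingAlgorithm S n d) (ω : Outcome S n d) : Option (Equiv.Perm (Fin n)) :=
  if h : ∃ t, (A.action ω t).isRight = true then (A.action ω (Nat.find h)).getRight? else none

/-- The probability when algorithm `A` is run on problem `ν`: the seed follows its law, all
potential samples are independent of it and of each other, and those of the pair `(i, j)` follow
`ν i j`. -/
def prob (A : RankingAlgorithm S n d) (ν : Problem n d) : Measure (Outcome S n d) :=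
  (A.seedLaw : Measure S).prod
    (Measure.infinitePi fun _ : ℕ =>
      Measure.pi fun i => Measure.pi fun j => (ν i j : Measure ℝ))

/-- The expected number of queries of `A` on the problem `ν`. -/
def expectedQueries (A : RankingAlgorithm S n d) (ν : Problem n d) : ℝ≥0∞ :=
  ∫⁻ ω, (A.numQueries ω : ℝ≥0∞) ∂(A.prob ν)

/-- `A` is `δ`-accurate for ranking identification on the class `D` of problems: on each of them
its output differs from the correct ranking with probability at most `δ`. -/
def IsAccurateOn (A : RankingAlgorithm S n d) (D : Set (Problem n d)) (δ : ℝ) : Prop :=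
  ∀ ν ∈ D, ∀ π : Equiv.Perm (Fin n), IsRanking (meanMatrix ν) π →
    A.prob ν {ω | A.output ω ≠ some π} ≤ ENNReal.ofReal δ

end RankingAlgorithm

end ExpertRanking

end

/-! The base problem is Gaussian with unit variance: expert `i` has rank `i`, and each gap `Δ i` is
spread evenly, as `Δ i / √d`, over the `d` tasks. It works for every algorithm. For each `i`, the
alternative exchanges the adjacent experts `i` and `i + 1`. Only their two rows change, every entry
by `Δ i / √d`, so a query in these rows has divergence `Δ i ^ 2 / (2 * d)` and any other query has
none.

A `δ`-accurate algorithm has to tell the two problems apart. The divergence decomposition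
(`integral_llr_history`) and a Bretagnolle–Huber type testing inequality (`log_le_sum_prob_query`)
then give `E[N_i + N_{i+1}] / 2 ≥ d / Δ i ^ 2 * log (1 / (4 * δ))`, with `N_i` the number of queries
to expert `i` and the expectation taken under the base problem. Summed over `i`, the left sides
count each query at most twice with weight `1 / 2` (`sum_adjacent_le_two`), so they total at most
`E[N]`.

The change of measure is carried out at a fixed horizon `T`, for the algorithm made absorbing after
termination (`stopped`). A run still active at `T` is charged to the error probability. If `E[N]` is
finite this charge vanishes as `T → ∞`; if it is infinite there is nothing to prove. -/

noncomputable section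

namespace ExpertRanking

/-! ### Histories, and their independence of the next table of samples -/

/-- The law of a full table of samples, one for each expert-task pair. -/
def tableLaw {n d : ℕ} (ν : Problem n d) : Measure (Fin n → Fin d → ℝ) :=
  Measure.pi fun i => Measure.pi fun j => (ν i j : Measure ℝ)

instance {n d : ℕ} (ν : Problem n d) : IsProbabilityMeasure (tableLaw ν) := by
  unfold tableLaw; infer_instance

lemma measurePreserving_tableLaw_eval {n d : ℕ} (ν : Problem n d) (i : Fin n) (j : Fin d) :
    MeasurePreserving (fun r : Fin n → Fin d → ℝ => r i j) (tableLaw ν) (ν i j) :=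
  (measurePreserving_eval (fun j => (ν i j : Measure ℝ)) j).comp
    (measurePreserving_eval (fun i => Measure.pi fun j => (ν i j : Measure ℝ)) i)

/-- The sample that a decision reveals in a table, with the value `0` after termination. -/
def reveal {n d : ℕ} (a : (Fin n × Fin d) ⊕ Equiv.Perm (Fin n)) (r : Fin n → Fin d → ℝ) : ℝ :=
  match a with
  | Sum.inl q => r q.1 q.2
  | Sum.inr _ => 0

namespace RankingAlgorithm

variable {S : Type*} [MeasurableSpace S] {n d : ℕ}

instance (A : RankingAlgorithm S n d) (ν : Problem n d) : IsProbabilityMeasure (A.prob ν) := by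
  unfold prob; infer_instance

/-- The seed together with the first `t` observations. -/
def history (A : RankingAlgorithm S n d) (t : ℕ) (ω : Outcome S n d) : S × (Fin t → ℝ) :=
  (ω.1, A.observations ω t)

/-- The history after one more query, given the table of the potential samples. -/
def extendHistory (A : RankingAlgorithm S n d) (t : ℕ)
    (x : (S × (Fin t → ℝ)) × (Fin n → Fin d → ℝ)) : S × (Fin (t + 1) → ℝ) :=
  (x.1.1, Fin.snoc (α := fun _ => ℝ) x.1.2 (reveal (A.decision t x.1.1 x.1.2) x.2))

lemma observations_succ (A : RankingAlgorithm S n d) (ω : Outcome S n d) (t : ℕ) :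
    A.observations ω (t + 1) = Fin.snoc (α := fun _ => ℝ) (A.observations ω t)
      (reveal (A.action ω t) (ω.2 t)) := by
  rw [observations, action]
  cases A.decision t ω.1 (A.observations ω t) <;> rfl

lemma history_succ (A : RankingAlgorithm S n d) (t : ℕ) (ω : Outcome S n d) :
    A.history (t + 1) ω = A.extendHistory t (A.history t ω, ω.2 t) := by
  rw [history, observations_succ]; rfl

lemma measurable_ite_decision (A : RankingAlgorithm S n d) (t : ℕ)
    (a : (Fin n × Fin d) ⊕ Equiv.Perm (Fin n)) {X β : Type*} [MeasurableSpace X]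
    [MeasurableSpace β] {h : X → S × (Fin t → ℝ)} (hh : Measurable h) {f g : X → β}
    (hf : Measurable f) (hg : Measurable g) :
    Measurable fun x => if A.decision t (h x).1 (h x).2 = a then f x else g x :=
  Measurable.ite (hh (A.measurableSet_decision t a)) hf hg

/-- As a finite sum over the possible queries, the revealed sample is measurable as soon as the
events "the decision is `a`" are. -/
lemma reveal_eq_sum (a : (Fin n × Fin d) ⊕ Equiv.Perm (Fin n)) (r : Fin n → Fin d → ℝ) :
    reveal a r = ∑ q : Fin n × Fin d, if a = Sum.inl q then r q.1 q.2 else 0 := by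
  cases a <;> simp [reveal]

lemma measurable_extendHistory (A : RankingAlgorithm S n d) (t : ℕ) :
    Measurable (A.extendHistory t) := by
  refine Measurable.prodMk (by fun_prop) (measurable_pi_iff.2 fun i => ?_)
  refine Fin.lastCases ?_ (fun i => ?_) i
  · simp only [Fin.snoc_last, reveal_eq_sum]
    exact Finset.measurable_sum _ fun q _ =>
      A.measurable_ite_decision t _ (h := Prod.fst) measurable_fst (by fun_prop) (by fun_prop)
  · simp only [Fin.snoc_castSucc]
    fun_prop

lemma measurable_history (A : RankingAlgorithm S n d) (t : ℕ) : Measurable (A.history t) := by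
  induction t with
  | zero =>
    refine Measurable.prodMk (by fun_prop) (measurable_pi_iff.2 fun i => i.elim0)
  | succ t ih =>
    have : A.history (t + 1) = fun ω => A.extendHistory t (A.history t ω, ω.2 t) :=
      funext fun ω => A.history_succ t ω
    rw [this]
    exact (A.measurable_extendHistory t).comp (ih.prodMk (by fun_prop))

lemma measurableSet_action_eq (A : RankingAlgorithm S n d) (t : ℕ)
    (a : (Fin n × Fin d) ⊕ Equiv.Perm (Fin n)) : MeasurableSet {ω | A.action ω t = a} :=
  A.measurable_history t (A.measurableSet_decision t a)

lemma observations_congr (A : RankingAlgorithm S n d) (s : S) {r r' : ℕ → Fin n → Fin d → ℝ}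
    {t : ℕ} (h : ∀ k < t, r k = r' k) :
    A.observations (s, r) t = A.observations (s, r') t := by
  induction t with
  | zero => rfl
  | succ t ih =>
    have := ih fun k hk => h k (by omega)
    simp only [observations_succ, action, this, h t (by omega)]

/-- For a fixed seed, the first `t` observations are a function of the tables with index `< t`,
which are jointly independent of table `t`. -/
lemma indepFun_observations (A : RankingAlgorithm S n d) (ν : Problem n d) (s : S) (t : ℕ) :
    IndepFun (fun r : ℕ → Fin n → Fin d → ℝ => A.observations (s, r) t) (fun r => r t)
      (Measure.infinitePi fun _ : ℕ => tableLaw ν) := by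
  have h := (iIndepFun_infinitePi (P := fun _ : ℕ => tableLaw ν) (X := fun _ r => r)
    (fun _ => measurable_id)).indepFun_finset (Finset.range t) {t} (by simp)
    (fun i => measurable_pi_apply i)
  -- The padding value `0` is never read: the first `t` observations only look at indices below `t`.
  let extend : ((Finset.range t) → Fin n → Fin d → ℝ) → ℕ → Fin n → Fin d → ℝ :=
    fun r i => if hi : i ∈ Finset.range t then r ⟨i, hi⟩ else 0
  have hext : Measurable extend := by
    refine measurable_pi_iff.2 fun i => ?_
    by_cases hi : i ∈ Finset.range t
    · simp only [extend, hi, dif_pos]; fun_prop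
    · simp only [extend, hi]; exact measurable_const
  have hφ : Measurable fun r => A.observations (s, extend r) t :=
    (measurable_snd.comp (A.measurable_history t)).comp (measurable_const.prodMk hext)
  have hψ : Measurable fun r : ({t} : Finset ℕ) → Fin n → Fin d → ℝ => r ⟨t, by simp⟩ := by
    fun_prop
  have h' := h.comp hφ hψ
  convert h' using 1
  · funext r
    refine A.observations_congr s fun k hk => ?_
    simp [extend, hk]
  · rfl

/-- Freezing the seed and using independence replaces the table at time `t` by a fresh copy, which
plays the role of conditioning on the history. -/
lemma lintegral_history_table (A : RankingAlgorithm S n d) (ν : Problem n d) (t : ℕ)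
    {F : (S × (Fin t → ℝ)) × (Fin n → Fin d → ℝ) → ℝ≥0∞} (hF : Measurable F) :
    ∫⁻ ω, F (A.history t ω, ω.2 t) ∂(A.prob ν)
      = ∫⁻ ω, ∫⁻ r, F (A.history t ω, r) ∂(tableLaw ν) ∂(A.prob ν) := by
  have hprob : A.prob ν = (A.seedLaw : Measure S).prod
    (Measure.infinitePi fun _ : ℕ => tableLaw ν) := rfl
  have hm := A.measurable_history t
  have hobs (s : S) : Measurable fun r : ℕ → Fin n → Fin d → ℝ => A.observations (s, r) t :=
    (measurable_snd.comp hm).comp (measurable_const.prodMk measurable_id)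
  rw [hprob, lintegral_prod (fun ω : Outcome S n d => F (A.history t ω, ω.2 t))
      (hF.comp (hm.prodMk (by fun_prop))).aemeasurable,
    lintegral_prod (fun ω : Outcome S n d => ∫⁻ r, F (A.history t ω, r) ∂(tableLaw ν))
      ((hF.lintegral_prod_right').comp hm).aemeasurable]
  refine lintegral_congr fun s => ?_
  have hmap := (A.indepFun_observations ν s t).map_prod_eq_prod_map_map
    (hobs s).aemeasurable (measurable_pi_apply t).aemeasurable
  rw [Measure.infinitePi_map_eval] at hmap
  have hFs : Measurable fun p : (Fin t → ℝ) × (Fin n → Fin d → ℝ) => F ((s, p.1), p.2) := by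
    fun_prop
  calc ∫⁻ r, F (A.history t (s, r), r t) ∂(Measure.infinitePi fun _ : ℕ => tableLaw ν)
      = ∫⁻ p, F ((s, p.1), p.2) ∂((Measure.infinitePi fun _ : ℕ => tableLaw ν).map
          fun r => (A.observations (s, r) t, r t)) := by
        rw [lintegral_map hFs ((hobs s).prodMk (by fun_prop))]; rfl
    _ = _ := by
        rw [hmap, lintegral_prod _ hFs.aemeasurable,
          lintegral_map hFs.lintegral_prod_right' (hobs s)]
        rfl

lemma indepFun_history_table (A : RankingAlgorithm S n d) (ν : Problem n d) (t : ℕ) :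
    IndepFun (A.history t) (fun ω => ω.2 t) (A.prob ν) := by
  have hm := A.measurable_history t
  have hr : Measurable fun ω : Outcome S n d => ω.2 t := by fun_prop
  rw [indepFun_iff_measure_inter_preimage_eq_mul]
  intro B C hB hC
  have key (D : Set (S × (Fin t → ℝ))) (hD : MeasurableSet D) :
      A.prob ν (A.history t ⁻¹' D ∩ (fun ω => ω.2 t) ⁻¹' C)
        = A.prob ν (A.history t ⁻¹' D) * tableLaw ν C := by
    rw [← lintegral_indicator_one ((hm hD).inter (hr hC)), ← lintegral_indicator_one (hm hD),
      ← lintegral_mul_const _ (measurable_one.indicator (hm hD))]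
    refine Eq.trans ?_ ((A.lintegral_history_table ν t (F := (D ×ˢ C).indicator 1)
      (measurable_one.indicator (hD.prod hC))).trans ?_)
    · refine lintegral_congr fun ω => ?_
      by_cases h : A.history t ω ∈ D <;> by_cases h' : ω.2 t ∈ C <;> simp [h, h']
    · refine lintegral_congr fun ω => ?_
      by_cases h : A.history t ω ∈ D
      · rw [Set.indicator_of_mem (s := A.history t ⁻¹' D) h, Pi.one_apply, one_mul,
          ← lintegral_indicator_one hC]
        refine lintegral_congr fun r => ?_
        by_cases h' : r ∈ C <;> simp [h, h']
      · simp [h]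
  have h1 := key Set.univ MeasurableSet.univ
  simp only [Set.preimage_univ, Set.univ_inter, measure_univ, one_mul] at h1
  rw [key B hB, h1]

lemma measurePreserving_sample (A : RankingAlgorithm S n d) (ν : Problem n d) (t : ℕ) (i : Fin n)
    (j : Fin d) : MeasurePreserving (fun ω : Outcome S n d => ω.2 t i j) (A.prob ν) (ν i j) :=
  (measurePreserving_tableLaw_eval ν i j).comp
    ((measurePreserving_eval_infinitePi (fun _ : ℕ => tableLaw ν) t).comp
      (measurePreserving_snd (μ := (A.seedLaw : Measure S))))

lemma lintegral_history_succ (A : RankingAlgorithm S n d) (ν : Problem n d) (t : ℕ)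
    {F : S × (Fin (t + 1) → ℝ) → ℝ≥0∞} (hF : Measurable F) :
    ∫⁻ ω, F (A.history (t + 1) ω) ∂(A.prob ν)
      = ∫⁻ ω, ∫⁻ r, F (A.extendHistory t (A.history t ω, r)) ∂(tableLaw ν) ∂(A.prob ν) := by
  simp_rw [history_succ]
  exact A.lintegral_history_table ν t (hF.comp (A.measurable_extendHistory t))

end RankingAlgorithm

/-! ### Gaussian likelihood ratios for one sample -/

/-- The problem whose samples are Gaussian with unit variance and the given means. -/
def gaussianProblem {n d : ℕ} (a : Fin n → Fin d → ℝ) : Problem n d :=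
  fun i j => ⟨gaussianReal (a i j) 1, inferInstance⟩

/-- The logarithm of the density of `N(b, 1)` with respect to `N(a, 1)`. -/
def gaussianLLR (a b x : ℝ) : ℝ := (b - a) * (x - a) - (b - a) ^ 2 / 2

@[fun_prop]
lemma measurable_gaussianLLR (a b : ℝ) : Measurable (gaussianLLR a b) := by
  unfold gaussianLLR; fun_prop

lemma gaussianReal_eq_withDensity (a b : ℝ) :
    gaussianReal b 1 = (gaussianReal a 1).withDensity
      fun x => ENNReal.ofReal (Real.exp (gaussianLLR a b x)) := by
  rw [gaussianReal_of_var_ne_zero _ one_ne_zero, gaussianReal_of_var_ne_zero _ one_ne_zero,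
    ← withDensity_mul _ (measurable_gaussianPDF _ _) (by fun_prop)]
  congr 1
  funext x
  rw [Pi.mul_apply, gaussianPDF, gaussianPDF,
    ← ENNReal.ofReal_mul (gaussianPDFReal_nonneg _ _ _), gaussianPDFReal, gaussianPDFReal,
    mul_assoc (√_)⁻¹, ← Real.exp_add, gaussianLLR]
  congr 3
  push_cast
  ring

lemma lintegral_gaussianReal_change (a b : ℝ) {f : ℝ → ℝ≥0∞} (hf : Measurable f) :
    ∫⁻ x, f x ∂(gaussianReal b 1)
      = ∫⁻ x, f x * ENNReal.ofReal (Real.exp (gaussianLLR a b x)) ∂(gaussianReal a 1) := by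
  rw [gaussianReal_eq_withDensity a b,
    lintegral_withDensity_eq_lintegral_mul _ (by fun_prop) hf]
  exact lintegral_congr fun x => mul_comm _ _

lemma integrable_gaussianLLR (a b : ℝ) : Integrable (gaussianLLR a b) (gaussianReal a 1) := by
  have h : Integrable (fun x : ℝ => x) (gaussianReal a 1) :=
    (memLp_id_gaussianReal (μ := a) (v := 1) 1).integrable le_rfl
  exact ((h.sub (integrable_const a)).const_mul (b - a)).sub (integrable_const _)

lemma integral_gaussianLLR (a b : ℝ) :
    ∫ x, gaussianLLR a b x ∂(gaussianReal a 1) = -((b - a) ^ 2 / 2) := by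
  have h : Integrable (fun x : ℝ => x) (gaussianReal a 1) :=
    (memLp_id_gaussianReal (μ := a) (v := 1) 1).integrable le_rfl
  have h1 : Integrable (fun x : ℝ => (b - a) * (x - a)) (gaussianReal a 1) :=
    (h.sub (integrable_const a)).const_mul (b - a)
  simp only [gaussianLLR]
  rw [integral_sub h1 (integrable_const _), integral_const_mul, integral_sub h (integrable_const a),
    integral_id_gaussianReal]
  simp

/-- The contribution of one decision and its observation to the log-likelihood ratio. -/
def llrIncrement {n d : ℕ} (a b : Fin n → Fin d → ℝ)
    (c : (Fin n × Fin d) ⊕ Equiv.Perm (Fin n)) (x : ℝ) : ℝ :=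
  ∑ q : Fin n × Fin d, if c = Sum.inl q then gaussianLLR (a q.1 q.2) (b q.1 q.2) x else 0

lemma measurable_llrIncrement {n d : ℕ} (a b : Fin n → Fin d → ℝ)
    (c : (Fin n × Fin d) ⊕ Equiv.Perm (Fin n)) : Measurable (llrIncrement a b c) := by
  refine Finset.measurable_sum _ fun q _ => ?_
  split_ifs <;> fun_prop

lemma llrIncrement_reveal {n d : ℕ} (a b : Fin n → Fin d → ℝ)
    (c : (Fin n × Fin d) ⊕ Equiv.Perm (Fin n)) (r : Fin n → Fin d → ℝ) :
    llrIncrement a b c (reveal c r) = ∑ q : Fin n × Fin d,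
      if c = Sum.inl q then gaussianLLR (a q.1 q.2) (b q.1 q.2) (r q.1 q.2) else 0 := by
  refine Finset.sum_congr rfl fun q _ => ?_
  split_ifs with h
  · rw [h, reveal]
  · rfl

/-- Only the revealed entry matters, so the change of measure concerns a single Gaussian marginal.
After termination the observation is the constant `0` and the density is `1`. -/
lemma lintegral_reveal_change {n d : ℕ} (a b : Fin n → Fin d → ℝ)
    (c : (Fin n × Fin d) ⊕ Equiv.Perm (Fin n)) {g : ℝ → ℝ≥0∞} (hg : Measurable g) :
    ∫⁻ r, g (reveal c r) ∂(tableLaw (gaussianProblem b))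
      = ∫⁻ r, g (reveal c r) * ENNReal.ofReal (Real.exp (llrIncrement a b c (reveal c r)))
          ∂(tableLaw (gaussianProblem a)) := by
  cases c with
  | inl q =>
    have h (e : Fin n → Fin d → ℝ) {f : ℝ → ℝ≥0∞} (hf : Measurable f) :
        ∫⁻ r, f (reveal (Sum.inl q) r) ∂(tableLaw (gaussianProblem e))
          = ∫⁻ x, f x ∂(gaussianReal (e q.1 q.2) 1) :=
      (measurePreserving_tableLaw_eval (gaussianProblem e) q.1 q.2).lintegral_comp hf
    have hm := measurable_llrIncrement a b (Sum.inl q)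
    rw [h b hg, h a (f := fun x => g x * ENNReal.ofReal (Real.exp (llrIncrement a b _ x)))
      (by fun_prop), lintegral_gaussianReal_change (a q.1 q.2) _ hg]
    simp [llrIncrement]
  | inr p => simp [llrIncrement, reveal]

/-! ### Likelihood ratio of a run and divergence decomposition -/

namespace RankingAlgorithm

variable {S : Type*} [MeasurableSpace S] {n d : ℕ}

/-- The log-likelihood ratio of the Gaussian problem with means `b` with respect to the one with
means `a`, as a function of the seed and the first `t` observations. -/
def llr (A : RankingAlgorithm S n d) (a b : Fin n → Fin d → ℝ) :
    (t : ℕ) → S × (Fin t → ℝ) → ℝ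
  | 0, _ => 0
  | t + 1, x => A.llr a b t (x.1, fun i => x.2 i.castSucc)
      + llrIncrement a b (A.decision t x.1 fun i => x.2 i.castSucc) (x.2 (Fin.last t))

lemma measurable_llr (A : RankingAlgorithm S n d) (a b : Fin n → Fin d → ℝ) (t : ℕ) :
    Measurable (A.llr a b t) := by
  induction t with
  | zero => exact measurable_const
  | succ t ih =>
    have hinit : Measurable fun x : S × (Fin (t + 1) → ℝ) =>
      (x.1, fun i : Fin t => x.2 i.castSucc) := by fun_prop
    simp only [llr, llrIncrement]
    refine (ih.comp hinit).add (Finset.measurable_sum _ fun q _ => ?_)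
    exact A.measurable_ite_decision t _ hinit (by fun_prop) (by fun_prop)

lemma llr_extendHistory (A : RankingAlgorithm S n d) (a b : Fin n → Fin d → ℝ) (t : ℕ)
    (h : S × (Fin t → ℝ)) (r : Fin n → Fin d → ℝ) :
    A.llr a b (t + 1) (A.extendHistory t (h, r)) = A.llr a b t h
      + llrIncrement a b (A.decision t h.1 h.2) (reveal (A.decision t h.1 h.2) r) := by
  simp [llr, extendHistory]

/-- The change of measure between two Gaussian problems, on the first `t` observations. -/
lemma lintegral_history_change (A : RankingAlgorithm S n d) (a b : Fin n → Fin d → ℝ) (t : ℕ)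
    {f : S × (Fin t → ℝ) → ℝ≥0∞} (hf : Measurable f) :
    ∫⁻ ω, f (A.history t ω) ∂(A.prob (gaussianProblem b))
      = ∫⁻ ω, f (A.history t ω) * ENNReal.ofReal (Real.exp (A.llr a b t (A.history t ω)))
          ∂(A.prob (gaussianProblem a)) := by
  induction t with
  | zero =>
    have h (e : Fin n → Fin d → ℝ) :
        ∫⁻ ω, f (A.history 0 ω) ∂(A.prob (gaussianProblem e))
          = ∫⁻ s, f (s, Fin.elim0) ∂(A.seedLaw : Measure S) :=
      (measurePreserving_fst (μ := (A.seedLaw : Measure S))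
        (ν := Measure.infinitePi fun _ : ℕ => tableLaw (gaussianProblem e))).lintegral_comp
        (f := fun s => f (s, Fin.elim0)) (by fun_prop)
    simp [llr, h]
  | succ t ih =>
    have hext := A.measurable_extendHistory t
    have hllr := A.measurable_llr a b (t + 1)
    rw [A.lintegral_history_succ _ t hf, ih (f := fun h => ∫⁻ r, f (A.extendHistory t (h, r))
        ∂(tableLaw (gaussianProblem b))) (hf.comp hext).lintegral_prod_right',
      A.lintegral_history_succ _ t
        (F := fun h => f h * ENNReal.ofReal (Real.exp (A.llr a b (t + 1) h))) (by fun_prop)]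
    refine lintegral_congr fun ω => ?_
    generalize A.history t ω = h
    have hsnoc : Measurable fun x : ℝ => (h.1, Fin.snoc (α := fun _ => ℝ) h.2 x) := by
      refine Measurable.prodMk (by fun_prop) (measurable_pi_iff.2 fun i => ?_)
      refine Fin.lastCases ?_ (fun i => ?_) i
      · simp only [Fin.snoc_last]; fun_prop
      · simp only [Fin.snoc_castSucc]; fun_prop
    -- With the history frozen, the next decision is deterministic and the one-sample change of
    -- measure applies.
    have key := lintegral_reveal_change a b (A.decision t h.1 h.2) (hf.comp hsnoc)
    simp only [llr_extendHistory, Real.exp_add]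
    refine (congrArg (· * _) key).trans ?_
    rw [← lintegral_mul_const' _ _ ENNReal.ofReal_ne_top]
    refine lintegral_congr fun r => ?_
    rw [ENNReal.ofReal_mul (Real.exp_nonneg _), mul_assoc, mul_comm (ENNReal.ofReal _)]
    rfl

lemma llr_history_succ (A : RankingAlgorithm S n d) (a b : Fin n → Fin d → ℝ) (t : ℕ)
    (ω : Outcome S n d) :
    A.llr a b (t + 1) (A.history (t + 1) ω) = A.llr a b t (A.history t ω)
      + ∑ q : Fin n × Fin d, {ω | A.action ω t = Sum.inl q}.indicator
          (fun ω => gaussianLLR (a q.1 q.2) (b q.1 q.2) (ω.2 t q.1 q.2)) ω := by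
  rw [history_succ, llr_extendHistory, llrIncrement_reveal]
  congr 1
  refine Finset.sum_congr rfl fun q _ => ?_
  classical
  rw [Set.indicator_apply]
  rfl

lemma integrable_gaussianLLR_sample (A : RankingAlgorithm S n d) (a b : Fin n → Fin d → ℝ)
    (t : ℕ) (i : Fin n) (j : Fin d) :
    Integrable (fun ω : Outcome S n d => gaussianLLR (a i j) (b i j) (ω.2 t i j))
      (A.prob (gaussianProblem a)) :=
  (A.measurePreserving_sample (gaussianProblem a) t i j).integrable_comp_of_integrable
    (integrable_gaussianLLR (a i j) (b i j))

lemma integrable_llr_history (A : RankingAlgorithm S n d) (a b : Fin n → Fin d → ℝ) (t : ℕ) :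
    Integrable (fun ω => A.llr a b t (A.history t ω)) (A.prob (gaussianProblem a)) := by
  induction t with
  | zero => exact integrable_zero _ _ _
  | succ t ih =>
    simp_rw [llr_history_succ]
    exact ih.add (integrable_finsetSum _ fun q _ =>
      (A.integrable_gaussianLLR_sample a b t q.1 q.2).indicator (A.measurableSet_action_eq t _))

/-- Whether `q` is queried at time `t` is decided by the history, which is independent of the sample
at time `t`; the expectation factors. -/
lemma integral_indicator_gaussianLLR (A : RankingAlgorithm S n d) (a b : Fin n → Fin d → ℝ)
    (t : ℕ) (q : Fin n × Fin d) :
    ∫ ω, {ω | A.action ω t = Sum.inl q}.indicator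
        (fun ω => gaussianLLR (a q.1 q.2) (b q.1 q.2) (ω.2 t q.1 q.2)) ω
        ∂(A.prob (gaussianProblem a))
      = -((A.prob (gaussianProblem a)).real {ω | A.action ω t = Sum.inl q}
          * ((b q.1 q.2 - a q.1 q.2) ^ 2 / 2)) := by
  set P := A.prob (gaussianProblem a)
  let B : Set (S × (Fin t → ℝ)) := {p | A.decision t p.1 p.2 = Sum.inl q}
  have hB : MeasurableSet B := A.measurableSet_decision t _
  have hmul := ((A.indepFun_history_table (gaussianProblem a) t).comp
    (φ := B.indicator (1 : S × (Fin t → ℝ) → ℝ))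
    (ψ := fun r => gaussianLLR (a q.1 q.2) (b q.1 q.2) (r q.1 q.2))
    (measurable_one.indicator hB) (by fun_prop)).integral_fun_mul_eq_mul_integral
    (((measurable_one.indicator hB).comp (A.measurable_history t)).aestronglyMeasurable)
    (Measurable.aestronglyMeasurable (by fun_prop))
  have h1 : ∫ ω, (B.indicator (1 : S × (Fin t → ℝ) → ℝ) ∘ A.history t) ω ∂P
      = P.real {ω | A.action ω t = Sum.inl q} := by
    rw [← integral_indicator_one (A.measurableSet_action_eq t (Sum.inl q))]
    rfl
  have h2 : ∫ ω : Outcome S n d, gaussianLLR (a q.1 q.2) (b q.1 q.2) (ω.2 t q.1 q.2) ∂P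
      = -((b q.1 q.2 - a q.1 q.2) ^ 2 / 2) := by
    have hs := A.measurePreserving_sample (gaussianProblem a) t q.1 q.2
    rw [← integral_gaussianLLR]
    change _ = ∫ x, _ ∂(gaussianProblem a q.1 q.2 : Measure ℝ)
    rw [← hs.map_eq, integral_map hs.measurable.aemeasurable
      (Measurable.aestronglyMeasurable (by fun_prop))]
  rw [← mul_neg, ← h1, ← h2]
  refine Eq.trans (integral_congr_ae (ae_of_all _ fun ω => ?_)) hmul
  by_cases h : A.action ω t = Sum.inl q
  · have h' : A.history t ω ∈ B := h
    simp [h, h']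
  · have h' : A.history t ω ∉ B := h
    simp [h, h']

/-- The divergence decomposition: the expected log-likelihood ratio is the sum of the divergences
of the samples, weighted by the probabilities of the queries. -/
lemma integral_llr_history (A : RankingAlgorithm S n d) (a b : Fin n → Fin d → ℝ) (T : ℕ) :
    ∫ ω, A.llr a b T (A.history T ω) ∂(A.prob (gaussianProblem a))
      = -∑ t ∈ Finset.range T, ∑ q : Fin n × Fin d,
          (A.prob (gaussianProblem a)).real {ω | A.action ω t = Sum.inl q}
            * ((b q.1 q.2 - a q.1 q.2) ^ 2 / 2) := by
  induction T with
  | zero => simp [llr]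
  | succ T ih =>
    have hi (q : Fin n × Fin d) := (A.integrable_gaussianLLR_sample a b T q.1 q.2).indicator
      (A.measurableSet_action_eq T (Sum.inl q))
    simp_rw [llr_history_succ]
    rw [integral_add (A.integrable_llr_history a b T) (integrable_finsetSum _ fun q _ => hi q),
      integral_finsetSum _ fun q _ => hi q, ih, Finset.sum_range_succ, neg_add,
      ← Finset.sum_neg_distrib (s := Finset.univ)]
    simp_rw [integral_indicator_gaussianLLR]

lemma integrable_exp_llr_history (A : RankingAlgorithm S n d) (a b : Fin n → Fin d → ℝ) (t : ℕ) :
    Integrable (fun ω => Real.exp (A.llr a b t (A.history t ω)))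
      (A.prob (gaussianProblem a)) := by
  have hm := (A.measurable_llr a b t).comp (A.measurable_history t)
  refine ⟨(Real.measurable_exp.comp hm).aestronglyMeasurable, ?_⟩
  rw [hasFiniteIntegral_iff_ofReal (ae_of_all _ fun ω => (Real.exp_pos _).le)]
  have h := A.lintegral_history_change a b t (f := 1) measurable_one
  simp only [Pi.one_apply, lintegral_one, measure_univ, one_mul] at h
  rw [← h]
  exact ENNReal.one_lt_top

lemma setIntegral_exp_llr_history (A : RankingAlgorithm S n d) (a b : Fin n → Fin d → ℝ) (t : ℕ)
    {B : Set (S × (Fin t → ℝ))} (hB : MeasurableSet B) :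
    ∫ ω in A.history t ⁻¹' B, Real.exp (A.llr a b t (A.history t ω))
        ∂(A.prob (gaussianProblem a))
      = (A.prob (gaussianProblem b)).real (A.history t ⁻¹' B) := by
  have hE := A.measurable_history t hB
  have hm : Measurable fun ω => A.llr a b t (A.history t ω) :=
    (A.measurable_llr a b t).comp (A.measurable_history t)
  rw [integral_eq_lintegral_of_nonneg_ae (ae_of_all _ fun ω => (Real.exp_pos _).le)
    hm.exp.aestronglyMeasurable, Measure.real, ← lintegral_indicator_one hE,
    ← lintegral_indicator hE]
  congr 1
  refine Eq.trans ?_ (A.lintegral_history_change a b t (f := B.indicator 1)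
    (measurable_one.indicator hB)).symm
  refine lintegral_congr fun ω => ?_
  by_cases h : A.history t ω ∈ B <;> simp [h]

/-! ### The testing inequality -/

/-- If an event that is decided by the first `T` observations is likely under one of two Gaussian
problems and unlikely under the other one, then many informative queries are made. -/
lemma log_le_sum_prob_query (A : RankingAlgorithm S n d) (a b : Fin n → Fin d → ℝ) (T : ℕ)
    {B : Set (S × (Fin T → ℝ))} (hB : MeasurableSet B) {ε : ℝ} (hε : 0 < ε)
    (ha : (A.prob (gaussianProblem a)).real (A.history T ⁻¹' Bᶜ) ≤ ε)
    (hb : (A.prob (gaussianProblem b)).real (A.history T ⁻¹' B) ≤ ε) :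
    Real.log (1 / (4 * ε)) ≤ ∑ t ∈ Finset.range T, ∑ q : Fin n × Fin d,
      (A.prob (gaussianProblem a)).real {ω | A.action ω t = Sum.inl q}
        * ((b q.1 q.2 - a q.1 q.2) ^ 2 / 2) := by
  set P := A.prob (gaussianProblem a)
  set Q := A.prob (gaussianProblem b)
  set L : Outcome S n d → ℝ := fun ω => A.llr a b T (A.history T ω)
  have hL : Integrable L P := A.integrable_llr_history a b T
  have hw : Integrable (fun ω => Real.exp (L ω)) P := A.integrable_exp_llr_history a b T
  set E := A.history T ⁻¹' B
  have hE : MeasurableSet E := A.measurable_history T hB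
  have ha : P.real Eᶜ ≤ ε := ha
  have hwE : ∫ ω in E, Real.exp (L ω) ∂P = Q.real E := A.setIntegral_exp_llr_history a b T hB
  have hwEc : ∫ ω in Eᶜ, Real.exp (L ω) ∂P = Q.real Eᶜ :=
    A.setIntegral_exp_llr_history a b T hB.compl
  -- The choice `k = 2 * √ε` makes the four error terms below add up to at most `1`, which cancels
  -- the `1` of the tangent-line bound for `exp` and leaves `E[L] ≤ 2 * log k = log (4 * ε)`.
  obtain ⟨k, hk, hk2⟩ : ∃ k : ℝ, 0 < k ∧ k ^ 2 = 4 * ε :=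
    ⟨√(4 * ε), by positivity, Real.sq_sqrt (by positivity)⟩
  have hpt (ω) : L ω / 2 - Real.log k + 1 ≤ Real.exp (L ω / 2) / k := by
    have := Real.add_one_le_exp (L ω / 2 - Real.log k)
    rwa [Real.exp_sub, Real.exp_log hk] at this
  have hsq (ω) : Real.exp (L ω) = Real.exp (L ω / 2) ^ 2 := by
    rw [← Real.exp_nat_mul]; congr 1; push_cast; ring
  have hint0 : Integrable (fun ω => L ω / 2 - Real.log k) P :=
    (hL.div_const 2).sub (integrable_const _)
  have hint : Integrable (fun ω => L ω / 2 - Real.log k + 1) P := hint0.add (integrable_const _)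
  -- AM-GM splits `exp (L / 2) / k` so that the factor `1 / (4 * ε)` falls on the small probability:
  -- that of `E` under `Q` here, that of `Eᶜ` under `P` in `h2`.
  have h1 : ∫ ω in E, (L ω / 2 - Real.log k + 1) ∂P ≤ Q.real E / (4 * ε) + P.real E / 4 := by
    calc _ ≤ ∫ ω in E, (Real.exp (L ω) / (4 * ε) + 1 / 4) ∂P := by
          refine setIntegral_mono hint.integrableOn
            ((hw.div_const _).add (integrable_const _)).integrableOn fun ω => (hpt ω).trans ?_
          rw [hsq, ← hk2, ← div_pow]
          nlinarith [sq_nonneg (Real.exp (L ω / 2) / k - 1 / 2)]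
      _ = _ := by
          rw [integral_add (hw.div_const _).integrableOn (integrable_const _).integrableOn,
            integral_div, hwE, setIntegral_const, smul_eq_mul]
          ring
  have h2 : ∫ ω in Eᶜ, (L ω / 2 - Real.log k + 1) ∂P ≤ Q.real Eᶜ / 4 + P.real Eᶜ / (4 * ε) := by
    calc _ ≤ ∫ ω in Eᶜ, (Real.exp (L ω) / 4 + 1 / (4 * ε)) ∂P := by
          refine setIntegral_mono hint.integrableOn
            ((hw.div_const _).add (integrable_const _)).integrableOn fun ω => (hpt ω).trans ?_
          rw [hsq, ← hk2, div_eq_mul_one_div, ← one_div_pow]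
          nlinarith [sq_nonneg (Real.exp (L ω / 2) / 2 - 1 / k)]
      _ = _ := by
          rw [integral_add (hw.div_const _).integrableOn (integrable_const _).integrableOn,
            integral_div, hwEc, setIntegral_const, smul_eq_mul]
          ring
  have h3 := integral_add_compl hE hint
  rw [integral_add hint0 (integrable_const _),
    integral_sub (hL.div_const 2) (integrable_const _), integral_div,
    A.integral_llr_history a b T] at h3
  simp only [integral_const, probReal_univ, smul_eq_mul, one_mul] at h3
  have h4 : Q.real E / (4 * ε) ≤ 1 / 4 := by rw [div_le_iff₀ (by positivity)]; linarith
  have h5 : P.real Eᶜ / (4 * ε) ≤ 1 / 4 := by rw [div_le_iff₀ (by positivity)]; linarith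
  have h6 : P.real E ≤ 1 := measureReal_le_one
  have h7 : Q.real Eᶜ ≤ 1 := measureReal_le_one
  have h8 : Real.log (1 / (4 * ε)) = -(2 * Real.log k) := by
    rw [← hk2, one_div, Real.log_inv, Real.log_pow]; norm_num
  rw [h8]
  linarith

/-! ### Absorbing termination and the number of queries -/

lemma numQueries_output_of_first (A : RankingAlgorithm S n d) (ω : Outcome S n d) {t : ℕ}
    (h : ∀ k < t, (A.action ω k).isRight = false) (ht : (A.action ω t).isRight = true) :
    A.numQueries ω = t ∧ A.output ω = (A.action ω t).getRight? := by
  classical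
  have hex : ∃ t, (A.action ω t).isRight = true := ⟨t, ht⟩
  have hfind : Nat.find hex = t :=
    (Nat.find_eq_iff hex).2 ⟨ht, fun k hk => by simp [h k hk]⟩
  rw [numQueries, output, dif_pos hex, dif_pos hex]
  refine ⟨?_, ?_⟩
  · convert congrArg (Nat.cast : ℕ → ℕ∞) hfind
  · convert congrArg (fun t => (A.action ω t).getRight?) hfind

lemma numQueries_output_of_never (A : RankingAlgorithm S n d) (ω : Outcome S n d)
    (h : ∀ k, (A.action ω k).isRight = false) : A.numQueries ω = ⊤ ∧ A.output ω = none := by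
  have hex : ¬∃ t, (A.action ω t).isRight = true := by simp [h]
  rw [numQueries, output, dif_neg hex, dif_neg hex]
  exact ⟨rfl, rfl⟩

lemma exists_first_or_never (A : RankingAlgorithm S n d) (ω : Outcome S n d) :
    (∃ t, (∀ k < t, (A.action ω k).isRight = false) ∧ (A.action ω t).isRight = true) ∨
      ∀ k, (A.action ω k).isRight = false := by
  classical
  by_cases hex : ∃ t, (A.action ω t).isRight = true
  · exact Or.inl ⟨Nat.find hex, fun k hk => by simpa using Nat.find_min hex hk, Nat.find_spec hex⟩
  · exact Or.inr (by simpa using hex)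

/-- The decisions of an algorithm, modified so that a termination is final. -/
def stoppedDecision (A : RankingAlgorithm S n d) :
    (t : ℕ) → S → (Fin t → ℝ) → (Fin n × Fin d) ⊕ Equiv.Perm (Fin n)
  | 0, s, o => A.decision 0 s o
  | t + 1, s, o => Sum.elim (fun _ => A.decision (t + 1) s o) Sum.inr
      (A.stoppedDecision t s fun i => o i.castSucc)

lemma measurableSet_stoppedDecision (A : RankingAlgorithm S n d) (t : ℕ)
    (a : (Fin n × Fin d) ⊕ Equiv.Perm (Fin n)) :
    MeasurableSet {p : S × (Fin t → ℝ) | A.stoppedDecision t p.1 p.2 = a} := by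
  induction t generalizing a with
  | zero => exact A.measurableSet_decision 0 a
  | succ t ih =>
    have hinit : Measurable fun x : S × (Fin (t + 1) → ℝ) =>
      (x.1, fun i : Fin t => x.2 i.castSucc) := by fun_prop
    have : {p : S × (Fin (t + 1) → ℝ) | A.stoppedDecision (t + 1) p.1 p.2 = a}
        = ⋃ c, {p | A.stoppedDecision t p.1 (fun i => p.2 i.castSucc) = c}
          ∩ {p | Sum.elim (fun _ => A.decision (t + 1) p.1 p.2) Sum.inr c = a} := by
      ext p
      simp [stoppedDecision]
    rw [this]
    refine MeasurableSet.iUnion fun c => (hinit (ih c)).inter ?_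
    cases c with
    | inl q => exact A.measurableSet_decision (t + 1) a
    | inr π => simp only [Sum.elim_inr, MeasurableSet.const]

/-- The algorithm that follows `A` until it terminates, and repeats the output of `A` afterwards. -/
def stopped (A : RankingAlgorithm S n d) : RankingAlgorithm S n d where
  seedLaw := A.seedLaw
  decision := A.stoppedDecision
  measurableSet_decision := A.measurableSet_stoppedDecision

lemma stopped_action_succ (A : RankingAlgorithm S n d) (ω : Outcome S n d) (t : ℕ) :
    A.stopped.action ω (t + 1)
      = Sum.elim (fun _ => A.decision (t + 1) ω.1 (A.stopped.observations ω (t + 1))) Sum.inr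
          (A.stopped.action ω t) := by
  change A.stoppedDecision (t + 1) _ _ = _
  rw [stoppedDecision, observations_succ]
  simp only [Fin.snoc_castSucc]
  rfl

lemma stopped_observations_action (A : RankingAlgorithm S n d) (ω : Outcome S n d) (t : ℕ)
    (h : ∀ k < t, (A.action ω k).isRight = false) :
    A.stopped.observations ω t = A.observations ω t ∧ A.stopped.action ω t = A.action ω t := by
  induction t with
  | zero => exact ⟨rfl, rfl⟩
  | succ t ih =>
    obtain ⟨h1, h2⟩ := ih fun k hk => h k (by omega)
    have h3 : A.stopped.observations ω (t + 1) = A.observations ω (t + 1) := by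
      rw [observations_succ, observations_succ, h1, h2]
    refine ⟨h3, ?_⟩
    have h4 := h t (by omega)
    rw [stopped_action_succ, h2, h3]
    cases hc : A.action ω t with
    | inl q => rfl
    | inr π => simp [hc] at h4

lemma stopped_action_eq_inr (A : RankingAlgorithm S n d) (ω : Outcome S n d) {t k : ℕ}
    (htk : t ≤ k) {π : Equiv.Perm (Fin n)} (h : A.stopped.action ω t = Sum.inr π) :
    A.stopped.action ω k = Sum.inr π := by
  induction k, htk using Nat.le_induction with
  | base => exact h
  | succ k _ ih => rw [stopped_action_succ, ih]; rfl

/-- Both algorithms make the same decisions up to and including the first termination, and neither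
quantity depends on what follows. Accuracy and cost therefore transfer to the absorbing version,
whose decision at `T` tells whether it has terminated and with which output. -/
lemma stopped_numQueries_output (A : RankingAlgorithm S n d) (ω : Outcome S n d) :
    A.stopped.numQueries ω = A.numQueries ω ∧ A.stopped.output ω = A.output ω := by
  have heq := A.stopped_observations_action ω
  rcases A.exists_first_or_never ω with ⟨t, h, ht⟩ | h
  · have h1 (k) (hk : k ≤ t) := (heq k fun l hl => h l (by omega)).2
    obtain ⟨h2, h3⟩ := A.numQueries_output_of_first ω h ht
    obtain ⟨h4, h5⟩ := A.stopped.numQueries_output_of_first ω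
      (fun k hk => by rw [h1 k hk.le, h k hk]) (by rw [h1 t le_rfl, ht])
    rw [h2, h3, h4, h5, h1 t le_rfl]
    exact ⟨rfl, rfl⟩
  · obtain ⟨h2, h3⟩ := A.numQueries_output_of_never ω h
    obtain ⟨h4, h5⟩ := A.stopped.numQueries_output_of_never ω
      fun k => by rw [(heq k fun l _ => h l).2, h k]
    rw [h2, h3, h4, h5]
    exact ⟨rfl, rfl⟩

lemma output_eq_of_stopped_action (A : RankingAlgorithm S n d) {ω : Outcome S n d} {t : ℕ}
    {π : Equiv.Perm (Fin n)} (h : A.stopped.action ω t = Sum.inr π) : A.output ω = some π := by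
  rw [← (A.stopped_numQueries_output ω).2]
  rcases A.stopped.exists_first_or_never ω with ⟨k, hk, hk'⟩ | hn
  · rw [(A.stopped.numQueries_output_of_first ω hk hk').2]
    obtain ⟨π', hπ'⟩ := Sum.isRight_iff.1 hk'
    have hkt : k ≤ t := by
      by_contra! hlt
      simpa [h] using hk t hlt
    have := A.stopped_action_eq_inr ω hkt hπ'
    rw [h] at this
    rw [hπ', Sum.inr_injective this]
    rfl
  · simpa [h] using hn t

lemma measurableSet_stopped_isLeft (A : RankingAlgorithm S n d) (t : ℕ) :
    MeasurableSet {ω | (A.stopped.action ω t).isLeft = true} := by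
  have : {ω | (A.stopped.action ω t).isLeft = true}
      = ⋃ q, {ω | A.stopped.action ω t = Sum.inl q} := by
    ext ω
    simp [Sum.isLeft_iff]
  rw [this]
  exact MeasurableSet.iUnion fun q => A.stopped.measurableSet_action_eq t _

lemma sum_indicator_le_numQueries (A : RankingAlgorithm S n d) (ω : Outcome S n d) (T : ℕ) :
    ∑ t ∈ Finset.range T, {ω | (A.stopped.action ω t).isLeft = true}.indicator (1 : Outcome S n d → ℝ≥0∞) ω
      ≤ A.numQueries ω := by
  rw [← (A.stopped_numQueries_output ω).1]
  rcases A.stopped.exists_first_or_never ω with ⟨k, hk, hk'⟩ | hn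
  · rw [(A.stopped.numQueries_output_of_first ω hk hk').1]
    obtain ⟨π, hπ⟩ := Sum.isRight_iff.1 hk'
    calc _ ≤ ∑ t ∈ Finset.range T, if t < k then (1 : ℝ≥0∞) else 0 := by
          refine Finset.sum_le_sum fun t _ => ?_
          split_ifs with htk
          · exact Set.indicator_le_self _ (1 : Outcome S n d → ℝ≥0∞) ω
          · simp [A.stopped_action_eq_inr ω (not_lt.1 htk) hπ]
      _ = ((Finset.range T).filter (· < k)).card := by simp
      _ ≤ k := by
          refine Nat.cast_le.2 ((Finset.card_le_card fun t ht => ?_).trans (Finset.card_range k).le)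
          exact Finset.mem_range.2 (Finset.mem_filter.1 ht).2
  · simp [(A.stopped.numQueries_output_of_never ω hn).1]

lemma sum_prob_isLeft_le (A : RankingAlgorithm S n d) (ν : Problem n d) (T : ℕ) :
    ∑ t ∈ Finset.range T, A.prob ν {ω | (A.stopped.action ω t).isLeft = true}
      ≤ A.expectedQueries ν := by
  calc _ = ∑ t ∈ Finset.range T,
        ∫⁻ ω, {ω | (A.stopped.action ω t).isLeft = true}.indicator 1 ω ∂(A.prob ν) :=
        Finset.sum_congr rfl fun t _ =>
          (lintegral_indicator_one (A.measurableSet_stopped_isLeft t)).symm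
    _ = ∫⁻ ω, ∑ t ∈ Finset.range T,
        {ω | (A.stopped.action ω t).isLeft = true}.indicator 1 ω ∂(A.prob ν) :=
        (lintegral_finsetSum _ fun t _ =>
          measurable_one.indicator (A.measurableSet_stopped_isLeft t)).symm
    _ ≤ _ := lintegral_mono fun ω => A.sum_indicator_le_numQueries ω T

/-- The probabilities of still being active at time `t` have a sum bounded by `E[N]`, so they tend
to `0` when it is finite. -/
lemma tendsto_prob_isLeft (A : RankingAlgorithm S n d) (ν : Problem n d)
    (h : A.expectedQueries ν ≠ ⊤) :
    Filter.Tendsto (fun t => (A.prob ν).real {ω | (A.stopped.action ω t).isLeft = true})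
      Filter.atTop (nhds 0) := by
  have hsum : ∑' t, A.prob ν {ω | (A.stopped.action ω t).isLeft = true} ≤ A.expectedQueries ν := by
    rw [ENNReal.tsum_eq_iSup_nat]
    exact iSup_le fun T => A.sum_prob_isLeft_le ν T
  exact (ENNReal.tendsto_toReal ENNReal.zero_ne_top).comp
    (ENNReal.tendsto_atTop_zero_of_tsum_ne_top (ne_top_of_le_ne_top h hsum))

lemma prob_isLeft_eq_sum (A : RankingAlgorithm S n d) (ν : Problem n d) (t : ℕ) :
    (A.prob ν).real {ω | (A.stopped.action ω t).isLeft = true}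
      = ∑ q, (A.prob ν).real {ω | A.stopped.action ω t = Sum.inl q} := by
  have : {ω | (A.stopped.action ω t).isLeft = true}
      = ⋃ q, {ω | A.stopped.action ω t = Sum.inl q} := by
    ext ω
    simp [Sum.isLeft_iff]
  rw [this]
  refine measureReal_iUnion_fintype (fun q q' hqq' => ?_)
    fun q => A.stopped.measurableSet_action_eq t _
  refine Set.disjoint_left.2 fun ω hω hω' => hqq' ?_
  exact Sum.inl_injective ((Eq.symm hω).trans hω')

lemma sum_prob_query_le (A : RankingAlgorithm S n d) (ν : Problem n d)
    (h : A.expectedQueries ν ≠ ⊤) (T : ℕ) :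
    ∑ t ∈ Finset.range T, ∑ q, (A.prob ν).real {ω | A.stopped.action ω t = Sum.inl q}
      ≤ (A.expectedQueries ν).toReal := by
  simp_rw [← prob_isLeft_eq_sum]
  have := ENNReal.toReal_mono h (A.sum_prob_isLeft_le ν T)
  rwa [ENNReal.toReal_sum fun t _ => measure_ne_top _ _] at this

end RankingAlgorithm

/-! ### The hard Gaussian instances -/

lemma meanMatrix_gaussianProblem {n d : ℕ} (a : Fin n → Fin d → ℝ) :
    meanMatrix (gaussianProblem a) = a := by
  funext i j
  exact integral_id_gaussianReal

lemma isSubGaussian_gaussianProblem {n d : ℕ} (a : Fin n → Fin d → ℝ) :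
    IsSubGaussian (gaussianProblem a) := by
  intro i j
  rw [meanMatrix_gaussianProblem]
  change HasSubgaussianMGF (fun x => x - a i j) 1 (gaussianReal (a i j) 1)
  refine ⟨fun t => ?_, fun t => ?_⟩
  · have h := (integrable_exp_mul_gaussianReal (μ := a i j) (v := 1) t).mul_const
      (Real.exp (-(t * a i j)))
    refine h.congr (ae_of_all _ fun x => ?_)
    simp only [← Real.exp_add]
    ring_nf
  · rw [mgf_gaussianReal (gaussianReal_map_sub_const (a i j))]
    simp

/-- The mean of the expert of rank `i` when the gaps `Δ` are spread evenly over the `d` tasks. -/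
def rankValue {m : ℕ} (d : ℕ) (Δ : Fin m → ℝ) (i : Fin (m + 1)) : ℝ :=
  ∑ k : Fin m, if i ≤ k.castSucc then Δ k / √d else 0

lemma rankValue_sub {m : ℕ} (d : ℕ) (Δ : Fin m → ℝ) (i : Fin m) :
    rankValue d Δ i.castSucc - rankValue d Δ i.succ = Δ i / √d := by
  rw [rankValue, rankValue, ← Finset.sum_sub_distrib, Finset.sum_eq_single i]
  · simp
  · intro k _ hk
    have : i.castSucc ≤ k.castSucc ↔ i.succ ≤ k.castSucc := by
      simp only [Fin.le_def, Fin.val_castSucc, Fin.val_succ]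
      have := Fin.val_ne_of_ne hk
      omega
    simp [this]
  · simp

lemma rankValue_strictAnti {m d : ℕ} (hd : 1 ≤ d) {Δ : Fin m → ℝ} (hΔ : ∀ i, 0 < Δ i) :
    StrictAnti (rankValue d Δ) := by
  refine Fin.strictAnti_iff_succ_lt.2 fun i => ?_
  have hd' : (0 : ℝ) < √d := Real.sqrt_pos.2 (by exact_mod_cast hd)
  linarith [rankValue_sub d Δ i, div_pos (hΔ i) hd']

lemma rankValue_mem_Icc {m d : ℕ} {Δ : Fin m → ℝ} (hΔ : ∀ i, 0 < Δ i)
    (hΔd : ∑ i, Δ i ≤ √d) (i : Fin (m + 1)) : rankValue d Δ i ∈ Set.Icc (0 : ℝ) 1 := by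
  have h (k : Fin m) : 0 ≤ Δ k / √d := div_nonneg (hΔ k).le (Real.sqrt_nonneg _)
  refine ⟨Finset.sum_nonneg fun k _ => ?_, ?_⟩
  · split_ifs
    exacts [h k, le_rfl]
  · calc rankValue d Δ i ≤ ∑ k, Δ k / √d := by
          refine Finset.sum_le_sum fun k _ => ?_
          split_ifs
          exacts [le_rfl, h k]
      _ ≤ 1 := by
          rw [← Finset.sum_div]
          exact div_le_one_of_le₀ hΔd (Real.sqrt_nonneg _)

/-- The mean matrix with evenly spread gaps in which the expert `σ i` has rank `i`. -/
def rankMatrix {m : ℕ} (d : ℕ) (Δ : Fin m → ℝ) (σ : Equiv.Perm (Fin (m + 1))) :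
    Fin (m + 1) → Fin d → ℝ :=
  fun i _ => rankValue d Δ (σ.symm i)

lemma isRanking_rankMatrix {m d : ℕ} (hd : 1 ≤ d) {Δ : Fin m → ℝ} (hΔ : ∀ i, 0 < Δ i)
    (σ : Equiv.Perm (Fin (m + 1))) : IsRanking (rankMatrix d Δ σ) σ := by
  intro i k hik j
  simpa [rankMatrix] using (rankValue_strictAnti hd hΔ).antitone hik

/-- The map `σ⁻¹ ∘ π` is monotone because the values strictly decrease with rank; a monotone
bijection of a finite chain is the identity. -/
lemma IsRanking.eq_of_rankMatrix {m d : ℕ} (hd : 1 ≤ d) {Δ : Fin m → ℝ} (hΔ : ∀ i, 0 < Δ i)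
    {σ π : Equiv.Perm (Fin (m + 1))} (h : IsRanking (rankMatrix d Δ σ) π) : π = σ := by
  have hmono : Monotone fun i => σ.symm (π i) := fun i k hik =>
    (rankValue_strictAnti hd hΔ).le_iff_ge.1 (h i k hik ⟨0, hd⟩)
  have hstrict := hmono.strictMono_of_injective (σ.symm.injective.comp π.injective)
  have hid := hstrict.eq_id
  ext i
  rw [← Equiv.apply_symm_apply σ (π i)]
  exact congrArg (fun j => (σ j : ℕ)) (congrFun hid i)

lemma gaussianProblem_rankMatrix_mem {m d : ℕ} (hd : 1 ≤ d) {Δ : Fin m → ℝ}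
    (hΔ : ∀ i, 0 < Δ i) (hΔd : ∑ i, Δ i ≤ √d) (σ : Equiv.Perm (Fin (m + 1))) :
    gaussianProblem (rankMatrix d Δ σ) ∈ problemClass m d Δ := by
  refine ⟨isSubGaussian_gaussianProblem _, ?_, ?_⟩ <;> rw [meanMatrix_gaussianProblem]
  · refine ⟨⟨σ, isRanking_rankMatrix hd hΔ σ⟩, fun i _ => rankValue_mem_Icc hΔ hΔd _,
      fun i k hik => ⟨⟨0, hd⟩, fun h => hik ?_⟩⟩
    exact σ.symm.injective ((rankValue_strictAnti hd hΔ).injective h)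
  · intro π hπ i
    have hd' : (0 : ℝ) < d := by exact_mod_cast hd
    rw [hπ.eq_of_rankMatrix hd hΔ]
    simp only [rankMatrix, Equiv.symm_apply_apply, rankValue_sub, Finset.sum_const,
      Finset.card_univ, Fintype.card_fin, nsmul_eq_mul, div_pow, Real.sq_sqrt hd'.le]
    field_simp

lemma sq_rankMatrix_swap_sub {m : ℕ} (d : ℕ) (Δ : Fin m → ℝ) (i : Fin m)
    (q : Fin (m + 1) × Fin d) :
    (rankMatrix d Δ (Equiv.swap i.castSucc i.succ) q.1 q.2 - rankMatrix d Δ 1 q.1 q.2) ^ 2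
      = Δ i ^ 2 / d * ((if q.1 = i.castSucc then 1 else 0) + if q.1 = i.succ then 1 else 0) := by
  have hsub := rankValue_sub d Δ i
  have hsq : Δ i ^ 2 / d = (Δ i / √d) ^ 2 := by rw [div_pow, Real.sq_sqrt d.cast_nonneg]
  have hne : i.castSucc ≠ i.succ := Fin.castSucc_lt_succ.ne
  change (rankValue d Δ ((Equiv.swap i.castSucc i.succ).symm q.1) - rankValue d Δ q.1) ^ 2 = _
  rw [Equiv.symm_swap, hsq, ← hsub]
  by_cases h1 : q.1 = i.castSucc
  · rw [h1, Equiv.swap_apply_left, if_pos rfl, if_neg hne]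
    ring
  · by_cases h2 : q.1 = i.succ
    · rw [h2, Equiv.swap_apply_right, if_pos rfl, if_neg hne.symm]
      ring
    · simp [Equiv.swap_apply_of_ne_of_ne h1 h2, h1, h2]

/-- An expert belongs to at most two adjacent pairs, once as the better and once as the worse
member. -/
lemma sum_adjacent_le_two {m : ℕ} (r : Fin (m + 1)) :
    ∑ i : Fin m, ((if r = i.castSucc then (1 : ℝ) else 0) + if r = i.succ then 1 else 0) ≤ 2 := by
  have h (f : Fin m → Fin (m + 1)) (hf : Function.Injective f) :
      ∑ i : Fin m, (if r = f i then (1 : ℝ) else 0) ≤ 1 := by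
    rw [Finset.sum_boole, Nat.cast_le_one, Finset.card_le_one]
    intro i hi k hk
    exact hf ((Finset.mem_filter.1 hi).2.symm.trans (Finset.mem_filter.1 hk).2)
  rw [Finset.sum_add_distrib]
  linarith [h _ (Fin.castSucc_injective m), h _ (Fin.succ_injective m)]

/-! ### From pairwise tests to the total number of queries -/

namespace RankingAlgorithm

variable {S : Type*} [MeasurableSpace S]

lemma log_le_sum_prob_adjacent {m d : ℕ} (hd : 1 ≤ d) {Δ : Fin m → ℝ} (hΔ : ∀ i, 0 < Δ i)
    (hΔd : ∑ i, Δ i ≤ √d) {δ : ℝ} (hδ : 0 < δ) (A : RankingAlgorithm S (m + 1) d)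
    (hA : A.IsAccurateOn (problemClass m d Δ) δ) (i : Fin m) (T : ℕ) :
    d / Δ i ^ 2 * Real.log (1 / (4 * (δ + (A.prob (gaussianProblem (rankMatrix d Δ 1))).real
        {ω | (A.stopped.action ω T).isLeft = true})))
      ≤ ∑ t ∈ Finset.range T, ∑ q : Fin (m + 1) × Fin d,
          (A.prob (gaussianProblem (rankMatrix d Δ 1))).real {ω | A.stopped.action ω t = Sum.inl q}
            * (((if q.1 = i.castSucc then 1 else 0) + if q.1 = i.succ then 1 else 0) / 2) := by
  set P := A.prob (gaussianProblem (rankMatrix d Δ 1))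
  set Q := A.prob (gaussianProblem (rankMatrix d Δ (Equiv.swap i.castSucc i.succ)))
  -- At the horizon `T`, not having output `1` means either an error or a run still active; the
  -- second summand pays for the latter.
  set ε := δ + P.real {ω | (A.stopped.action ω T).isLeft = true} with hε
  have hδε : δ ≤ ε := le_add_of_nonneg_right measureReal_nonneg
  have hacc (σ : Equiv.Perm (Fin (m + 1))) :
      (A.prob (gaussianProblem (rankMatrix d Δ σ))).real {ω | A.output ω ≠ some σ} ≤ δ :=
    ENNReal.toReal_le_of_le_ofReal hδ.le <|
      hA _ (gaussianProblem_rankMatrix_mem hd hΔ hΔd σ) σ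
        (by rw [meanMatrix_gaussianProblem]; exact isRanking_rankMatrix hd hΔ σ)
  let B : Set (S × (Fin T → ℝ)) := {p | A.stopped.decision T p.1 p.2 = Sum.inr 1}
  have hQ : Q.real (A.stopped.history T ⁻¹' B) ≤ ε := by
    refine (measureReal_mono fun ω hω => ?_).trans ((hacc _).trans hδε)
    have hω' : A.output ω = some 1 := A.output_eq_of_stopped_action hω
    rw [Set.mem_ofPred_eq, hω', ne_eq, Option.some_inj]
    intro h
    have h1 := congrArg (fun σ : Equiv.Perm (Fin (m + 1)) => σ i.castSucc) h
    simp only [Equiv.Perm.one_apply, Equiv.swap_apply_left] at h1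
    exact Fin.castSucc_lt_succ.ne h1
  have hP : P.real (A.stopped.history T ⁻¹' Bᶜ) ≤ ε := by
    calc _ ≤ P.real ({ω | A.output ω ≠ some 1} ∪ {ω | (A.stopped.action ω T).isLeft = true}) := by
          refine measureReal_mono fun ω hω => ?_
          cases hc : A.stopped.action ω T with
          | inl q => right; simp [hc]
          | inr π =>
            left
            rw [Set.mem_ofPred_eq, A.output_eq_of_stopped_action hc, ne_eq, Option.some_inj]
            rintro rfl
            exact hω hc
      _ ≤ _ := (measureReal_union_le _ _).trans (add_le_add_left (hacc 1) _)
  have key := A.stopped.log_le_sum_prob_query _ _ T (A.stopped.measurableSet_decision T _)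
    (hδ.trans_le hδε) hP hQ
  have hΔi := hΔ i
  have hd' : (0 : ℝ) < d := by exact_mod_cast hd
  -- The prefactor cancels the `Δ i ^ 2 / d` of each squared mean difference, leaving the `1 / 2` of
  -- the Gaussian divergence.
  refine (mul_le_mul_of_nonneg_left key (by positivity)).trans_eq ?_
  simp_rw [Finset.mul_sum, sq_rankMatrix_swap_sub]
  refine Finset.sum_congr rfl fun t _ => Finset.sum_congr rfl fun q _ => ?_
  change _ * (P.real _ * _) = _
  field_simp

lemma sum_log_le_expectedQueries {m d : ℕ} (hd : 1 ≤ d) {Δ : Fin m → ℝ} (hΔ : ∀ i, 0 < Δ i)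
    (hΔd : ∑ i, Δ i ≤ √d) {δ : ℝ} (hδ : 0 < δ) (A : RankingAlgorithm S (m + 1) d)
    (hA : A.IsAccurateOn (problemClass m d Δ) δ)
    (hN : A.expectedQueries (gaussianProblem (rankMatrix d Δ 1)) ≠ ⊤) :
    ∑ i, (d : ℝ) / Δ i ^ 2 * Real.log (1 / (4 * δ))
      ≤ (A.expectedQueries (gaussianProblem (rankMatrix d Δ 1))).toReal := by
  have hlim := A.tendsto_prob_isLeft _ hN
  -- The bound holds at every horizon `T`; as the active probability tends to `0`, continuity of
  -- `log` at `4 * δ ≠ 0` gives the limit.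
  refine le_of_tendsto' (f := fun T => ∑ i, (d : ℝ) / Δ i ^ 2 * Real.log (1 / (4 * (δ +
    (A.prob (gaussianProblem (rankMatrix d Δ 1))).real
      {ω | (A.stopped.action ω T).isLeft = true})))) (x := Filter.atTop) ?_ fun T => ?_
  · refine tendsto_finsetSum _ fun i _ => Filter.Tendsto.const_mul _ ?_
    have h4 : 4 * (δ + 0) ≠ 0 := by positivity
    have := ((hlim.const_add δ).const_mul 4)
    simpa using (this.inv₀ h4).log (by positivity)
  · refine le_trans ?_ (A.sum_prob_query_le _ hN T)
    refine (Finset.sum_le_sum fun i _ =>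
      A.log_le_sum_prob_adjacent hd hΔ hΔd hδ hA i T).trans ?_
    rw [Finset.sum_comm]
    refine Finset.sum_le_sum fun t _ => ?_
    rw [Finset.sum_comm]
    refine Finset.sum_le_sum fun q _ => ?_
    -- For each query, the weights `1 / 2` of the adjacent pairs containing its expert add up to at
    -- most `1`.
    rw [← Finset.mul_sum, ← Finset.sum_div]
    refine mul_le_of_le_one_right measureReal_nonneg ?_
    linarith [sum_adjacent_le_two q.1]

end RankingAlgorithm

end ExpertRanking

end

theorem theorem5 {S : Type*} [MeasurableSpace S] (m d : ℕ) (hd : 1 ≤ d)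
    (Δ : Fin m → ℝ) (hΔ : ∀ i, 0 < Δ i) (hΔd : ∑ i, Δ i ≤ Real.sqrt d)
    (δ : ℝ) (hδ0 : 0 < δ) (hδ1 : δ < 1)
    (A : ExpertRanking.RankingAlgorithm S (m + 1) d)
    (hA : A.IsAccurateOn (ExpertRanking.problemClass m d Δ) δ) :
    ∃ ν ∈ ExpertRanking.problemClass m d Δ,
      ENNReal.ofReal (∑ i, (d : ℝ) / Δ i ^ 2 * Real.log (1 / (4 * δ))) ≤
        A.expectedQueries ν := by
  refine ⟨_, ExpertRanking.gaussianProblem_rankMatrix_mem hd hΔ hΔd 1, ?_⟩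
  by_cases hN : A.expectedQueries
      (ExpertRanking.gaussianProblem (ExpertRanking.rankMatrix d Δ 1)) = ⊤
  · rw [hN]
    exact le_top
  · exact ENNReal.ofReal_le_of_le_toReal (A.sum_log_le_expectedQueries hd hΔ hΔd hδ0 hA hN)
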